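/- Let $k$ be an arbitrary field. A functor is called right exact if it preserves finite colimits; for $k$-linear categories $T,C$ write $\mathrm{Rex}[T,C]$ for the category of right exact $k$-linear functors $T\to C$ and all natural transformations, and for $k$-linear categories $A,B,C$ write $\mathrm{Rex}[A,B;C]$ for the category of functors $A\otimes_k B\to C$ (that is, functors of two variables that are $k$-linear in each variable) which are right exact in each variable, and all natural transformations. A Deligne tensor product of two abelian $k$-linear categories $A,B$ is an abelian $k$-linear category $A\bullet B$ together with a functor $\chi\in\mathrm{Rex}[A,B;A\bullet B]$ such that, for every abelian $k$-linear category $C$, composition with $\chi$ is an equivalence of categories $\mathrm{Rex}[A\bullet B,C]\simeq\mathrm{Rex}[A,B;C]$. Then there exist two (small) abelian $k$-linear categories $A$ and $B$ for which no Deligne tensor product exists. -/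

import Mathlib

open CategoryTheory CategoryTheory.Limits

universe w v w₁ v₁ w₂ v₂ w₃ v₃ u

namespace DeligneTensor

section

variable (k : Type u) [CommRing k]

/-- A `k`-linear functor that is right exact, that is, preserves all finite colimits. -/
structure IsRex {T : Type w₁} [Category.{v₁} T] [Preadditive T] [Linear k T]
    {C : Type w₂} [Category.{v₂} C] [Preadditive C] [Linear k C] (F : T ⥤ C) : Prop where
  additive : F.Additive
  linear : F.Linear k
  preservesFiniteColimits : PreservesFiniteColimits F

/-- A functor of two variables `A ⊗ B ⥤ C` (that is, a functor `A ⥤ B ⥤ C` which is `k`-linear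
in each variable) that is right exact in each variable. -/
structure IsRexBilinear {A : Type w₁} [Category.{v₁} A] [Preadditive A] [Linear k A]
    {B : Type w₂} [Category.{v₂} B] [Preadditive B] [Linear k B]
    {C : Type w₃} [Category.{v₃} C] [Preadditive C] [Linear k C] (F : A ⥤ B ⥤ C) : Prop where
  right : ∀ a : A, IsRex k (F.obj a)
  left : ∀ b : B, IsRex k (F.flip.obj b)

/-- `Rex[T, C]`: the category of right exact `k`-linear functors `T ⥤ C`
and all natural transformations. -/
abbrev Rex (T : Type w₁) [Category.{v₁} T] [Preadditive T] [Linear k T]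
    (C : Type w₂) [Category.{v₂} C] [Preadditive C] [Linear k C] :=
  ObjectProperty.FullSubcategory (fun F : T ⥤ C => IsRex k F)

/-- `Rex[A, B; C]`: the category of functors of two variables from `A`, `B` to `C`, `k`-linear and
right exact in each variable, and all natural transformations. -/
abbrev RexBilinear (A : Type w₁) [Category.{v₁} A] [Preadditive A] [Linear k A]
    (B : Type w₂) [Category.{v₂} B] [Preadditive B] [Linear k B]
    (C : Type w₃) [Category.{v₃} C] [Preadditive C] [Linear k C] :=
  ObjectProperty.FullSubcategory (fun F : A ⥤ B ⥤ C => IsRexBilinear k F)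

end

section

variable {k : Type u} [CommRing k]

theorem IsRex.comp {S : Type w₁} [Category.{v₁} S] [Preadditive S] [Linear k S]
    {T : Type w₂} [Category.{v₂} T] [Preadditive T] [Linear k T]
    {C : Type w₃} [Category.{v₃} C] [Preadditive C] [Linear k C] {F : S ⥤ T} {G : T ⥤ C}
    (hF : IsRex k F) (hG : IsRex k G) : IsRex k (F ⋙ G) := by
  have := hF.additive
  have := hG.additive
  have := hF.linear
  have := hG.linear
  have := hF.preservesFiniteColimits
  have := hG.preservesFiniteColimits
  exact ⟨inferInstance, inferInstance, comp_preservesFiniteColimits F G⟩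

variable {A : Type w₁} [Category.{v₁} A] [Preadditive A] [Linear k A]
  {B : Type w₂} [Category.{v₂} B] [Preadditive B] [Linear k B]
  {T : Type w₃} [Category.{v₃} T] [Preadditive T] [Linear k T]

/-- Composition with `χ : A ⥤ B ⥤ T`, sending `F : T ⥤ C` to `(a, b) ↦ F (χ (a, b))`. -/
abbrev precomp (χ : A ⥤ B ⥤ T) (C : Type w) [Category.{v} C] : (T ⥤ C) ⥤ (A ⥤ B ⥤ C) :=
  Functor.whiskeringRight B T C ⋙ (Functor.whiskeringLeft A (B ⥤ T) (B ⥤ C)).obj χ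

theorem IsRexBilinear.precomp_obj {χ : A ⥤ B ⥤ T} (hχ : IsRexBilinear k χ)
    {C : Type w} [Category.{v} C] [Preadditive C] [Linear k C] {F : T ⥤ C} (hF : IsRex k F) :
    IsRexBilinear k ((precomp χ C).obj F) where
  right a := (hχ.right a).comp hF
  left b := (hχ.left b).comp hF

/-- Composition with `χ` as a functor `Rex[T, C] ⥤ Rex[A, B; C]`. -/
def rexPrecomp {χ : A ⥤ B ⥤ T} (hχ : IsRexBilinear k χ)
    (C : Type w) [Category.{v} C] [Preadditive C] [Linear k C] :
    Rex k T C ⥤ RexBilinear k A B C :=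
  ObjectProperty.lift _ (ObjectProperty.ι _ ⋙ precomp χ C)
    (fun F => hχ.precomp_obj F.property)

end

section

variable (k : Type u) [CommRing k]

/-- The functor `χ : A ⊗ B ⥤ T` into an abelian `k`-linear category `T` exhibits `T` as Deligne's
tensor product of `A` and `B`: it is right exact in each variable and, for every abelian `k`-linear
category `C`, composition with `χ` is an equivalence `Rex[T, C] ≌ Rex[A, B; C]`. -/
structure IsDeligneTensor {A : Type w₁} [Category.{v₁} A] [Abelian A] [Linear k A]
    {B : Type w₂} [Category.{v₂} B] [Abelian B] [Linear k B]
    {T : Type w} [Category.{v} T] [Abelian T] [Linear k T] (χ : A ⥤ B ⥤ T) : Prop where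
  isRexBilinear : IsRexBilinear k χ
  isEquivalence : ∀ (C : Type w) [Category.{v} C] [Abelian C] [Linear k C],
    (rexPrecomp isRexBilinear C).IsEquivalence

/-- Deligne's tensor product of the abelian `k`-linear categories `A` and `B` exists. The tensor
product and the categories in its universal property range over all (possibly large, locally small)
abelian `k`-linear categories. -/
def HasDeligneTensor (A : Type w₁) [Category.{v₁} A] [Abelian A] [Linear k A]
    (B : Type w₂) [Category.{v₂} B] [Abelian B] [Linear k B] : Prop :=
  ∃ (T : Type (u + 1)) (_ : Category.{u} T) (_ : Abelian T) (_ : Linear k T) (χ : A ⥤ B ⥤ T),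
    IsDeligneTensor k χ

end

end DeligneTensor

/-! Let `R` be the product of the fields `k[x]/(p)` over all monic irreducible `p`, and take for
both `A` and `B` the finite projective `R`-modules. As `R` is von Neumann regular, this category is
abelian and every short exact sequence in it splits, so right exactness of an additive functor out
of it is automatic. The obstruction is that `Q = R ⊗ R` is not coherent: the annihilator of `d = x ⊗
1 - 1 ⊗ x` is not finitely generated.

Suppose `χ` into `T` is universal. `Q` acts on `χ(R, R)`, and base change gives a right exact `F`
from `T` to `Q`-modules with `F χ(R, R) ≅ Q`. The functors `F(-) ⊗ Q ^ J` and `F(-) ^ J` are right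
exact and agree on values of `χ`, hence on all of `T` (`MatCat.isIso_tensorToPower_app`); so every
`F X` behaves like a finitely presented module. Apply this to the kernel of `d` on `χ(R, R)`: every
`g` with `d g = 0` factors through that kernel, so its image under `F` maps onto the annihilator of
`d`, which would be finitely generated. But an annihilating element dies on almost all idempotents
`e_p ⊗ 1` (`eventually_idem_tmul_mul_eq_zero`), while for each `p` some annihilating element
survives (`exists_rootDiff_mul_eq_zero`). -/

namespace CategoryTheory

/-! ### Von Neumann regular categories -/

section

variable {C : Type w₁} [Category.{v₁} C]

/-- Every morphism of the category has a generalized inverse. -/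
def IsRegularCategory (C : Type w₁) [Category.{v₁} C] : Prop :=
  ∀ ⦃X Y : C⦄ (f : X ⟶ Y), ∃ g : Y ⟶ X, f ≫ g ≫ f = f

namespace IsRegularCategory

variable (hC : IsRegularCategory C)
include hC

theorem exists_retraction {X Y : C} (f : X ⟶ Y) [Mono f] : ∃ g : Y ⟶ X, f ≫ g = 𝟙 X := by
  obtain ⟨g, hg⟩ := hC f
  exact ⟨g, by rw [← cancel_mono f]; simpa using hg⟩

theorem exists_section {X Y : C} (f : X ⟶ Y) [Epi f] : ∃ g : Y ⟶ X, g ≫ f = 𝟙 Y := by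
  obtain ⟨g, hg⟩ := hC f
  exact ⟨g, by rw [← cancel_epi f]; simpa using hg⟩

variable [Preadditive C]

/-- If `f ≫ g ≫ f = f`, the idempotent `𝟙 X - f ≫ g` is killed by `f` and fixes every morphism that
`f` kills, so splitting it yields the kernel. -/
theorem hasKernels [IsIdempotentComplete C] : HasKernels C where
  has_limit {X Y} f := by
    obtain ⟨g, hg⟩ := hC f
    obtain ⟨Z, i, e, hie, hei⟩ := IsIdempotentComplete.idempotents_split X (𝟙 X - f ≫ g)
      (by simp [reassoc_of% hg])
    have hif : i ≫ f = 0 := by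
      have : (e ≫ i) ≫ f = 0 := by simp [hei, hg]
      rw [← Category.id_comp i, ← hie, Category.assoc, Category.assoc, ← Category.assoc e, this,
        comp_zero]
    have : Mono i := mono_of_mono_fac hie
    exact HasLimit.mk ⟨KernelFork.ofι i hif, KernelFork.IsLimit.ofι' i hif fun {W} h hh =>
      ⟨h ≫ e, by rw [Category.assoc, hei]; simp [reassoc_of% hh]⟩⟩

theorem hasCokernels [IsIdempotentComplete C] : HasCokernels C where
  has_colimit {X Y} f := by
    obtain ⟨g, hg⟩ := hC f
    obtain ⟨Z, i, e, hie, hei⟩ := IsIdempotentComplete.idempotents_split Y (𝟙 Y - g ≫ f)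
      (by simp [hg])
    have hfe : f ≫ e = 0 := by
      have : f ≫ e ≫ i = 0 := by simp [hei, hg]
      rw [← Category.comp_id e, ← hie, reassoc_of% this, zero_comp]
    have : Epi e := epi_of_epi_fac hie
    exact HasColimit.mk ⟨CokernelCofork.ofπ e hfe, CokernelCofork.IsColimit.ofπ' e hfe fun {W} h hh =>
      ⟨i ≫ h, by rw [← Category.assoc, hei]; simp [hh]⟩⟩

theorem isNormalMonoCategory : IsNormalMonoCategory C where
  normalMonoOfMono {X Y} f _ := by
    obtain ⟨g, hg⟩ := hC.exists_retraction f
    exact ⟨{ Z := Y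
             g := 𝟙 Y - g ≫ f
             w := by simp [reassoc_of% hg]
             isLimit := KernelFork.IsLimit.ofι' f _ fun {W} h hh =>
              ⟨h ≫ g, by rw [Preadditive.comp_sub, sub_eq_zero] at hh; simpa using hh.symm⟩ }⟩

theorem isNormalEpiCategory : IsNormalEpiCategory C where
  normalEpiOfEpi {X Y} f _ := by
    obtain ⟨g, hg⟩ := hC.exists_section f
    exact ⟨{ W := X
             g := 𝟙 X - f ≫ g
             w := by simp [hg]
             isColimit := CokernelCofork.IsColimit.ofπ' f _ fun {W} h hh =>
              ⟨g ≫ h, by rw [Preadditive.sub_comp, sub_eq_zero] at hh; simpa using hh.symm⟩ }⟩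

/-- An idempotent complete additive category in which all morphisms are regular is abelian. -/
@[reducible]
def abelian [IsIdempotentComplete C] [HasFiniteProducts C] : Abelian C :=
  have := hC.isNormalMonoCategory
  have := hC.isNormalEpiCategory
  have := hC.hasKernels
  have := hC.hasCokernels
  { }

end IsRegularCategory

/-- Monomorphisms split, hence so do short exact sequences, and additive functors preserve
splittings. -/
theorem IsRegularCategory.preservesFiniteColimits {C : Type w₁} [Category.{v₁} C] [Preadditive C]
    [IsIdempotentComplete C] [HasFiniteProducts C] (hC : IsRegularCategory C) {D : Type w₂}
    [Category.{v₂} D] [Abelian D] (F : C ⥤ D) [hF : F.Additive] : PreservesFiniteColimits F := by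
  let _ := hC.abelian
  have : F.Additive := hF
  refine ((Functor.preservesFiniteColimits_tfae F).out 0 3).1 fun S hS => ?_
  have := hS.mono_f
  have := hS.epi_g
  obtain ⟨r, hr⟩ := hC.exists_retraction S.f
  have s := ShortComplex.Splitting.ofExactOfRetraction S hS.exact r hr inferInstance
  exact ⟨(s.map F).exact, (s.map F).epi_g⟩

end

end CategoryTheory

/-! ### Linearity and regularity of the idempotent completion -/

namespace CategoryTheory.Idempotents

variable {C : Type w₁} [Category.{v₁} C] [Preadditive C]

namespace Karoubi

variable {S : Type w} [Semiring S] [Linear S C]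

instance (X Y : Karoubi C) : SMul S (X ⟶ Y) where
  smul s f := ⟨s • f.f, by simp⟩

theorem smul_f (s : S) {X Y : Karoubi C} (f : X ⟶ Y) : (s • f).f = s • f.f := rfl

instance (X Y : Karoubi C) : Module S (X ⟶ Y) :=
  Function.Injective.module S (inclusionHom X Y) (fun _ _ h => hom_ext _ _ h) (fun _ _ => rfl)

instance : Linear S (Karoubi C) where
  smul_comp _ _ _ s f g := hom_ext _ _ (by simp [smul_f])
  comp_smul _ _ _ f s g := hom_ext _ _ (by simp [smul_f])

end Karoubi

theorem Karoubi.isRegularCategory {C : Type w₁} [Category.{v₁} C] (hC : IsRegularCategory C) :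
    IsRegularCategory (Karoubi C) := fun X Y f => by
  obtain ⟨g, hg⟩ := hC f.f
  exact ⟨⟨Y.p ≫ g ≫ X.p, by simp⟩, by ext; simp [hg]⟩

end CategoryTheory.Idempotents

/-! ### Finite free modules as a small category -/

/-- The category of finite free modules over `R`, with one object for each natural number. -/
structure MatCat (R : Type u) : Type u where
  /-- the rank -/
  rank : ULift.{u} ℕ

namespace MatCat

variable {R : Type u} [CommRing R]

instance : SmallCategory (MatCat R) where
  Hom X Y := (Fin X.rank.down → R) →ₗ[R] (Fin Y.rank.down → R)
  id _ := LinearMap.id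
  comp f g := g.comp f

/-- The free module of rank `n`. -/
def free (R : Type u) (n : ℕ) : MatCat R := ⟨⟨n⟩⟩

instance (X Y : MatCat R) : AddCommGroup (X ⟶ Y) :=
  inferInstanceAs (AddCommGroup ((Fin X.rank.down → R) →ₗ[R] (Fin Y.rank.down → R)))

instance : Preadditive (MatCat R) where
  add_comp _ _ _ f f' g := LinearMap.comp_add _ _ _
  comp_add _ _ _ f g g' := LinearMap.add_comp _ _ _

instance (S : Type w) [CommRing S] [Algebra S R] (X Y : MatCat R) : Module S (X ⟶ Y) :=
  inferInstanceAs (Module S ((Fin X.rank.down → R) →ₗ[R] (Fin Y.rank.down → R)))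

instance (S : Type w) [CommRing S] [Algebra S R] : Linear S (MatCat R) where
  smul_comp X Y Z s f g :=
    let f' : (Fin X.rank.down → R) →ₗ[R] (Fin Y.rank.down → R) := f
    let g' : (Fin Y.rank.down → R) →ₗ[R] (Fin Z.rank.down → R) := g
    LinearMap.comp_smul g' s f'
  comp_smul _ _ _ f s g := rfl

instance : HasZeroObject (MatCat R) :=
  ⟨free R 0, (IsZero.iff_id_eq_zero _).2
    (LinearMap.ext fun _ => funext fun (i : Fin 0) => i.elim0)⟩

/-- The sum of two free modules. -/
def binaryBicone (X Y : MatCat R) : BinaryBicone X Y where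
  pt := free R (X.rank.down + Y.rank.down)
  fst := LinearMap.funLeft R R (Fin.castAdd _)
  snd := LinearMap.funLeft R R (Fin.natAdd _)
  inl := LinearMap.pi (Fin.addCases (fun i => LinearMap.proj i) fun _ => 0)
  inr := LinearMap.pi (Fin.addCases (fun _ => 0) fun i => LinearMap.proj i)
  inl_fst := LinearMap.ext fun x => funext fun i =>
    show (Fin.addCases _ _ (Fin.castAdd _ i) : (Fin X.rank.down → R) →ₗ[R] R) x = _ by
      rw [Fin.addCases_left]; rfl
  inl_snd := LinearMap.ext fun x => funext fun i =>
    show (Fin.addCases _ _ (Fin.natAdd _ i) : (Fin X.rank.down → R) →ₗ[R] R) x = _ by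
      rw [Fin.addCases_right]; rfl
  inr_fst := LinearMap.ext fun x => funext fun i =>
    show (Fin.addCases _ _ (Fin.castAdd _ i) : (Fin Y.rank.down → R) →ₗ[R] R) x = _ by
      rw [Fin.addCases_left]; rfl
  inr_snd := LinearMap.ext fun x => funext fun i =>
    show (Fin.addCases _ _ (Fin.natAdd _ i) : (Fin Y.rank.down → R) →ₗ[R] R) x = _ by
      rw [Fin.addCases_right]; rfl

instance : HasBinaryBiproducts (MatCat R) where
  has_binary_biproduct X Y := hasBinaryBiproduct_of_total (binaryBicone X Y)
    (LinearMap.ext fun x => funext fun i => by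
      refine Fin.addCases (fun j => ?_) (fun j => ?_) i
      · show (Fin.addCases (fun i => LinearMap.proj i) (fun _ => 0) (Fin.castAdd _ j) :
          (Fin X.rank.down → R) →ₗ[R] R) _ + (Fin.addCases (fun _ => 0) (fun i => LinearMap.proj i)
            (Fin.castAdd _ j) : (Fin Y.rank.down → R) →ₗ[R] R) _ = x _
        rw [Fin.addCases_left, Fin.addCases_left]
        exact add_zero _
      · show (Fin.addCases (fun i => LinearMap.proj i) (fun _ => 0) (Fin.natAdd _ j) :
          (Fin X.rank.down → R) →ₗ[R] R) _ + (Fin.addCases (fun _ => 0) (fun i => LinearMap.proj i)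
            (Fin.natAdd _ j) : (Fin Y.rank.down → R) →ₗ[R] R) _ = x _
        rw [Fin.addCases_right, Fin.addCases_right]
        exact zero_add _)

instance : HasFiniteBiproducts (MatCat R) :=
  have : HasFiniteProducts (MatCat R) := hasFiniteProducts_of_has_binary_and_terminal
  HasFiniteBiproducts.of_hasFiniteProducts

end MatCat

/-! ### Generation by one object under finite sums and retracts -/

open scoped TensorProduct

namespace CategoryTheory

/-- The identity of `X` is a finite sum of endomorphisms factoring through `G`. -/
def IsSummandOfSum {C : Type w₁} [Category.{v₁} C] [Preadditive C] (G X : C) : Prop :=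
  ∃ (n : ℕ) (i : Fin n → (X ⟶ G)) (p : Fin n → (G ⟶ X)), ∑ j, i j ≫ p j = 𝟙 X

namespace IsSummandOfSum

variable {C : Type w₁} [Category.{v₁} C] [Preadditive C]
  {D : Type w₂} [Category.{v₂} D] [Preadditive D]

theorem trans {G X Y : C} (h : IsSummandOfSum G X) (h' : IsSummandOfSum X Y) :
    IsSummandOfSum G Y := by
  obtain ⟨n, i, p, hip⟩ := h
  obtain ⟨m, i', p', hip'⟩ := h'
  refine ⟨m * n, fun a => i' (finProdFinEquiv.symm a).1 ≫ i (finProdFinEquiv.symm a).2,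
    fun a => p (finProdFinEquiv.symm a).2 ≫ p' (finProdFinEquiv.symm a).1, ?_⟩
  rw [Equiv.sum_comp finProdFinEquiv.symm
    (fun b : Fin m × Fin n => (i' b.1 ≫ i b.2) ≫ p b.2 ≫ p' b.1), Fintype.sum_prod_type, ← hip']
  refine Finset.sum_congr rfl fun a _ => ?_
  have := congrArg (fun t => i' a ≫ t ≫ p' a) hip
  simpa [Preadditive.sum_comp, Preadditive.comp_sum] using this

theorem map {G X : C} (h : IsSummandOfSum G X) (F : C ⥤ D) [F.Additive] :
    IsSummandOfSum (F.obj G) (F.obj X) := by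
  obtain ⟨n, i, p, hip⟩ := h
  exact ⟨n, fun j => F.map (i j), fun j => F.map (p j), by
    simp only [← F.map_comp, ← F.map_sum, hip, F.map_id]⟩

/-- The inverse at `X` is a sum of conjugates of the inverse at `G`. -/
theorem isIso_app {G X : C} (h : IsSummandOfSum G X) {F F' : C ⥤ D} [F.Additive] [F'.Additive]
    (τ : F ⟶ F') [IsIso (τ.app G)] : IsIso (τ.app X) := by
  obtain ⟨n, i, p, hip⟩ := h
  refine ⟨∑ j, F'.map (i j) ≫ inv (τ.app G) ≫ F.map (p j), ?_, ?_⟩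
  · simp only [Preadditive.comp_sum, ← NatTrans.naturality_assoc, IsIso.hom_inv_id_assoc,
      ← F.map_comp, ← F.map_sum, hip, F.map_id]
  · simp only [Preadditive.sum_comp, Category.assoc, NatTrans.naturality, IsIso.inv_hom_id_assoc,
      ← F'.map_comp, ← F'.map_sum, hip, F'.map_id]

end IsSummandOfSum

end CategoryTheory

namespace MatCat

open Idempotents

variable (R : Type u) [CommRing R]

theorem isSummandOfSum_free (X : MatCat R) : IsSummandOfSum (free R 1) X :=
  ⟨X.rank.down, fun j => LinearMap.pi fun _ => LinearMap.proj j,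
    fun j => LinearMap.single R (fun _ => R) j ∘ₗ LinearMap.proj (0 : Fin 1),
    LinearMap.ext fun x => by
      have h (s : Finset (Fin X.rank.down)) (g : Fin X.rank.down → (X ⟶ X)) :
          (∑ j ∈ s, g j : X ⟶ X) = (∑ j ∈ s, (g j :
            (Fin X.rank.down → R) →ₗ[R] (Fin X.rank.down → R))) := rfl
      rw [h, LinearMap.sum_apply]
      exact Finset.univ_sum_single x⟩

/-- The free module of rank one in the category of finite projective modules. -/
def one : Karoubi (MatCat R) := (toKaroubi _).obj (free R 1)

theorem isSummandOfSum_one (X : Karoubi (MatCat R)) : IsSummandOfSum (one R) X :=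
  ((isSummandOfSum_free R X.X).map (toKaroubi _)).trans
    ⟨1, fun _ => X.decompId_i, fun _ => X.decompId_p, by
      rw [Finset.univ_unique, Finset.sum_singleton, ← X.decompId]⟩

/-- Endomorphisms of the free module of rank one. -/
def oneEndEquiv : (one R ⟶ one R) ≃ₗ[R] R where
  toFun f := (show (Fin 1 → R) →ₗ[R] (Fin 1 → R) from f.f) 1 0
  invFun r := r • 𝟙 _
  map_add' _ _ := rfl
  map_smul' _ _ := rfl
  left_inv f := Karoubi.hom_ext _ _ <| LinearMap.ext fun (x : Fin 1 → R) => by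
    let f' : (Fin 1 → R) →ₗ[R] (Fin 1 → R) := f.f
    have hx : x = x 0 • 1 := funext fun i => by rw [Subsingleton.elim i 0]; simp
    change f' 1 0 • x = f' x
    have : f' x = x 0 • f' 1 := by rw [← map_smul, ← hx]
    rw [this]
    ext i
    rw [Subsingleton.elim i 0, Pi.smul_apply, Pi.smul_apply, smul_eq_mul, smul_eq_mul, mul_comm]
  right_inv r := mul_one r

end MatCat

/-! ### Tensoring with a power against taking powers -/

namespace ModuleCat

variable {Q : Type u} [CommRing Q] (J : Type u)

/-- The functor taking a module to its `J`-th power. -/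
def power : ModuleCat.{u} Q ⥤ ModuleCat.{u} Q where
  obj M := .of Q (J → M)
  map f := ofHom (f.hom.compLeft J)

instance : (power (Q := Q) J).Additive where

instance : PreservesFiniteColimits (power (Q := Q) J) := by
  refine ((Functor.preservesFiniteColimits_tfae _).out 0 3).1 fun S hS => ?_
  have hf := (ModuleCat.mono_iff_injective _).1 hS.mono_f
  have hg := (ModuleCat.epi_iff_surjective _).1 hS.epi_g
  have he := (ShortComplex.moduleCat_exact_iff _).1 hS.exact
  refine ⟨(ShortComplex.moduleCat_exact_iff _).2 fun x hx => ?_,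
    (ModuleCat.epi_iff_surjective _).2 fun x => ?_⟩
  · choose y hy using fun j => he (x j) (congrFun hx j)
    exact ⟨y, funext hy⟩
  · choose y hy using fun j => hg (x j)
    exact ⟨y, funext hy⟩

/-- The canonical map `M ⊗ Q ^ J ⟶ M ^ J`. -/
noncomputable def tensorToPower :
    MonoidalCategory.tensorRight (ModuleCat.of Q (J → Q)) ⟶ power (Q := Q) J where
  app M := ofHom (TensorProduct.lift (LinearMap.mk₂ Q (fun (m : M) (w : J → Q) j => w j • m)
    (fun _ _ _ => funext fun _ => smul_add _ _ _) (fun _ _ _ => funext fun _ => smul_comm _ _ _)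
    (fun _ _ _ => funext fun _ => add_smul _ _ _) (fun _ _ _ => funext fun _ => mul_smul _ _ _)))
  naturality M N f := by
    apply ModuleCat.hom_ext
    apply TensorProduct.ext'
    intro m w
    refine funext fun j => ?_
    exact (f.hom.map_smul (w j) m).symm

instance : IsIso ((tensorToPower (Q := Q) J).app (ModuleCat.of Q Q)) := by
  refine (ConcreteCategory.isIso_iff_bijective _).2 ?_
  have h : (⇑((tensorToPower (Q := Q) J).app (ModuleCat.of Q Q)) : _ → J → Q) =
      TensorProduct.lid Q (J → Q) := by
    funext z
    induction z using TensorProduct.induction_on with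
    | zero => exact (map_zero _).trans (map_zero _).symm
    | tmul m w => exact funext fun j => mul_comm _ _
    | add x y hx hy => exact (map_add _ x y).trans ((congrArg₂ _ hx hy).trans (map_add _ x y).symm)
  exact h ▸ (TensorProduct.lid Q (J → Q)).bijective

end ModuleCat

namespace DeligneTensor

variable {k : Type u} [Field k] {Q : Type u} [CommRing Q] [Algebra k Q]

theorem _root_.ModuleCat.algebraMap_smul_hom {M N : ModuleCat.{u} Q} (c : k) (f : M ⟶ N) :
    c • f = algebraMap k Q c • f := rfl

theorem isRex_power (J : Type u) : IsRex k (ModuleCat.power (Q := Q) J) where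
  additive := inferInstance
  linear := { map_smul := fun _ _ => rfl }
  preservesFiniteColimits := inferInstance

theorem isRex_tensorRight (W : ModuleCat.{u} Q) :
    IsRex k (MonoidalCategory.tensorRight W) where
  additive := inferInstance
  linear :=
    { map_smul := fun f c => by
        rw [ModuleCat.algebraMap_smul_hom, ModuleCat.algebraMap_smul_hom]
        exact MonoidalLinear.smul_whiskerRight (R := Q) _ f W }
  preservesFiniteColimits :=
    have : PreservesColimits (MonoidalCategory.tensorRight W) := inferInstance
    inferInstance

end DeligneTensor

/-! ### The test bifunctor given by base change -/

namespace MatCat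

open Idempotents MonoidalCategory

variable {R Q : Type u} [CommRing R] [CommRing Q]

/-- Extension of scalars, as a functor from the category of finite projective modules. -/
noncomputable def extend (φ : R →+* Q) : Karoubi (MatCat R) ⥤ ModuleCat.{u} Q :=
  (linearCoyoneda R (Karoubi (MatCat R))).obj (.op (one R)) ⋙ ModuleCat.extendScalars φ

theorem extend_map_smul (φ : R →+* Q) {X Y : Karoubi (MatCat R)} (r : R) (f : X ⟶ Y) :
    (extend φ).map (r • f) = φ r • (extend φ).map f := by
  refine ModuleCat.ExtendScalars.hom_ext (f := φ) fun (g : one R ⟶ X) => ?_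
  refine (ModuleCat.ExtendScalars.map_tmul φ _ _ _).trans ?_
  refine Eq.trans ?_ (congrArg (φ r • ·) (ModuleCat.ExtendScalars.map_tmul φ _ _ _)).symm
  let _ := φ.toAlgebra
  change (1 : Q) ⊗ₜ[R] (g ≫ (r • f)) = (φ r * 1) ⊗ₜ[R] (g ≫ f)
  rw [Linear.comp_smul, ← TensorProduct.smul_tmul, Algebra.smul_def]
  rfl

instance (φ : R →+* Q) : (extend φ).Additive where
  map_add {X Y f g} := by
    refine ModuleCat.ExtendScalars.hom_ext (f := φ) fun (h : one R ⟶ X) => ?_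
    let _ := φ.toAlgebra
    change (1 : Q) ⊗ₜ[R] (h ≫ (f + g)) = 1 ⊗ₜ[R] (h ≫ f) + 1 ⊗ₜ[R] (h ≫ g)
    rw [Preadditive.comp_add, TensorProduct.tmul_add]

/-- Extension of scalars takes the free module of rank one to the ring. -/
noncomputable def extendOne (φ : R →+* Q) : (extend φ).obj (one R) ≅ ModuleCat.of Q Q := by
  letI := φ.toAlgebra
  exact ((ModuleCat.extendScalars φ).mapIso (oneEndEquiv R).toModuleIso).trans
    (TensorProduct.AlgebraTensorModule.rid R Q Q).toModuleIso

/-- The tensor product of two extensions of scalars. -/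
noncomputable def extendTensor (φ ψ : R →+* Q) :
    Karoubi (MatCat R) ⥤ Karoubi (MatCat R) ⥤ ModuleCat.{u} Q :=
  extend φ ⋙ curriedTensor (ModuleCat.{u} Q) ⋙ (Functor.whiskeringLeft _ _ _).obj (extend ψ)

/-- The tensor product of two extensions of scalars takes the free modules of rank one to the ring. -/
noncomputable def extendTensorOne (φ ψ : R →+* Q) :
    ((extendTensor φ ψ).obj (one R)).obj (one R) ≅ ModuleCat.of Q Q :=
  (extendOne φ ⊗ᵢ extendOne ψ) ≪≫ λ_ (𝟙_ (ModuleCat.{u} Q))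

theorem extendTensor_map_smul_app (φ ψ : R →+* Q) {X X' : Karoubi (MatCat R)} (r : R) (f : X ⟶ X')
    (Y : Karoubi (MatCat R)) :
    ((extendTensor φ ψ).map (r • f)).app Y = φ r • ((extendTensor φ ψ).map f).app Y := by
  change (extend φ).map (r • f) ▷ _ = φ r • ((extend φ).map f ▷ _)
  rw [extend_map_smul, MonoidalLinear.smul_whiskerRight]

theorem extendTensor_obj_map_smul (φ ψ : R →+* Q) (X : Karoubi (MatCat R))
    {Y Y' : Karoubi (MatCat R)} (r : R) (f : Y ⟶ Y') :
    ((extendTensor φ ψ).obj X).map (r • f) = ψ r • ((extendTensor φ ψ).obj X).map f := by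
  change _ ◁ (extend ψ).map (r • f) = ψ r • (_ ◁ (extend ψ).map f)
  rw [extend_map_smul, MonoidalLinear.whiskerLeft_smul]

variable {k : Type u} [Field k] [Algebra k R] [Algebra k Q]

theorem algebraMap_smul_hom {X Y : Karoubi (MatCat R)} (c : k) (f : X ⟶ Y) :
    c • f = algebraMap k R c • f :=
  Karoubi.hom_ext _ _ (LinearMap.ext fun _ => (algebraMap_smul R c _).symm)

theorem smul_smul_hom {X Y : Karoubi (MatCat R)} (c : k) (r : R) (f : X ⟶ Y) :
    (c • r) • f = c • r • f := by
  rw [algebraMap_smul_hom, smul_smul, Algebra.smul_def]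

theorem isRexBilinear_extendTensor (hR : IsRegularCategory (MatCat R)) (φ ψ : R →ₐ[k] Q) :
    DeligneTensor.IsRexBilinear k (extendTensor φ.toRingHom ψ.toRingHom) where
  right X := by
    have : ((extendTensor φ.toRingHom ψ.toRingHom).obj X).Additive :=
      inferInstanceAs ((extend ψ.toRingHom) ⋙ tensorLeft ((extend φ.toRingHom).obj X)).Additive
    refine ⟨this, ⟨fun f c => ?_⟩, (Karoubi.isRegularCategory hR).preservesFiniteColimits _⟩
    rw [algebraMap_smul_hom, extendTensor_obj_map_smul, ModuleCat.algebraMap_smul_hom]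
    exact congrArg (· • _) (ψ.commutes c)
  left Y := by
    have : ((extendTensor φ.toRingHom ψ.toRingHom).flip.obj Y).Additive :=
      inferInstanceAs ((extend φ.toRingHom) ⋙ tensorRight ((extend ψ.toRingHom).obj Y)).Additive
    refine ⟨this, ⟨fun f c => ?_⟩, (Karoubi.isRegularCategory hR).preservesFiniteColimits _⟩
    rw [algebraMap_smul_hom, Functor.flip_obj_map, extendTensor_map_smul_app,
      ModuleCat.algebraMap_smul_hom]
    exact congrArg (· • _) (φ.commutes c)

end MatCat

/-! ### Regularity of matrices over products of fields -/

theorem LinearMap.exists_generalizedInverse {K V W : Type*} [Field K] [AddCommGroup V]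
    [Module K V] [AddCommGroup W] [Module K W] (f : V →ₗ[K] W) :
    ∃ g : W →ₗ[K] V, f ∘ₗ g ∘ₗ f = f := by
  obtain ⟨s, hs⟩ := f.rangeRestrict.exists_rightInverse_of_surjective f.range_rangeRestrict
  obtain ⟨g, hg⟩ := s.exists_extend
  refine ⟨g, LinearMap.ext fun v => ?_⟩
  have h1 : g (f v) = s (f.rangeRestrict v) := LinearMap.congr_fun hg (f.rangeRestrict v)
  have h2 := congrArg Subtype.val (LinearMap.congr_fun hs (f.rangeRestrict v))
  simpa [h1] using h2

theorem Matrix.exists_generalizedInverse {K m n : Type*} [Field K] [Fintype m] [Fintype n]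
    [DecidableEq m] [DecidableEq n] (M : Matrix m n K) : ∃ N : Matrix n m K, M * N * M = M := by
  obtain ⟨g, hg⟩ := (Matrix.toLin' M).exists_generalizedInverse
  refine ⟨LinearMap.toMatrix' g, Matrix.toLin'.injective ?_⟩
  rw [Matrix.toLin'_mul, Matrix.toLin'_mul, Matrix.toLin'_toMatrix', LinearMap.comp_assoc, hg]

theorem Matrix.exists_generalizedInverse_pi {J : Type*} {K : J → Type*} [∀ j, Field (K j)]
    {m n : Type*} [Fintype m] [Fintype n] [DecidableEq m] [DecidableEq n]
    (M : Matrix m n (∀ j, K j)) : ∃ N : Matrix n m (∀ j, K j), M * N * M = M := by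
  choose N hN using fun j => (M.map (Pi.evalRingHom K j)).exists_generalizedInverse
  refine ⟨.of fun a b j => N j a b, ?_⟩
  ext a b j
  have := congrFun (congrFun (hN j) a) b
  simpa [Matrix.mul_apply, Finset.sum_apply] using this

theorem MatCat.isRegularCategory_pi {J : Type u} (K : J → Type u) [∀ j, Field (K j)] :
    IsRegularCategory (MatCat (∀ j, K j)) := fun X Y f => by
  let f' : (Fin X.rank.down → (∀ j, K j)) →ₗ[∀ j, K j] (Fin Y.rank.down → (∀ j, K j)) := f
  obtain ⟨N, hN⟩ := (LinearMap.toMatrix' f').exists_generalizedInverse_pi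
  refine ⟨Matrix.toLin' N, ?_⟩
  have := congrArg Matrix.toLin' hN
  rw [Matrix.toLin'_mul, Matrix.toLin'_mul, Matrix.toLin'_toMatrix', LinearMap.comp_assoc] at this
  exact this

/-! ### Slices of a tensor -/

theorem TensorProduct.exists_rTensor_ne_zero {k V W : Type*} [Field k] [AddCommGroup V]
    [Module k V] [AddCommGroup W] [Module k W] {t : V ⊗[k] W} (ht : t ≠ 0) :
    ∃ φ : V →ₗ[k] k, TensorProduct.lid k W (φ.rTensor W t) ≠ 0 := by
  classical
  by_contra! h
  let b := Module.Basis.ofVectorSpace k V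
  refine ht ((TensorProduct.equivFinsuppOfBasisLeft (N := W) b).injective ?_)
  ext i
  rw [map_zero, TensorProduct.equivFinsuppOfBasisLeft_apply]
  exact h _

theorem TensorProduct.exists_fg_forall_rTensor_mem {k V W : Type*} [Field k] [AddCommGroup V]
    [Module k V] [AddCommGroup W] [Module k W] (t : V ⊗[k] W) :
    ∃ U : Submodule k W, U.FG ∧
      ∀ φ : V →ₗ[k] k, TensorProduct.lid k W (φ.rTensor W t) ∈ U := by
  induction t with
  | zero => exact ⟨⊥, Submodule.fg_bot, by simp⟩
  | tmul v w =>
    exact ⟨k ∙ w, Submodule.fg_span_singleton w, fun φ => by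
      simpa using Submodule.smul_mem _ _ (Submodule.mem_span_singleton_self w)⟩
  | add s t hs ht =>
    obtain ⟨U, hU, hU'⟩ := hs
    obtain ⟨U', hV, hV'⟩ := ht
    refine ⟨U ⊔ U', hU.sup hV, fun φ => ?_⟩
    rw [map_add, map_add]
    exact Submodule.add_mem_sup (hU' φ) (hV' φ)

/-- Each `j ∈ S` gives a nonzero slice of `q` supported at `j` alone. Disjoint supports make these
slices independent, yet all slices of `q` lie in one finite-dimensional space. -/
theorem Pi.finite_setOf_single_tmul_ne_zero {k J : Type*} [Field k] [DecidableEq J]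
    {K : J → Type*} [∀ j, Field (K j)] [∀ j, Algebra k (K j)]
    (q : (∀ j, K j) ⊗[k] (∀ j, K j)) (S : Set J)
    (hS : ∀ j ∈ S, ((Pi.single j 1 : ∀ j, K j) ⊗ₜ[k] (1 : ∀ j, K j)) * q ≠ 0 ∧
      ((Pi.single j 1 : ∀ j, K j) ⊗ₜ[k] (1 - Pi.single j 1 : ∀ j, K j)) * q = 0) : S.Finite := by
  obtain ⟨U, hU, hUφ⟩ := TensorProduct.exists_fg_forall_rTensor_mem q
  have key (r s : ∀ j, K j) (φ : (∀ j, K j) →ₗ[k] k) :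
      TensorProduct.lid k _ (φ.rTensor _ ((r ⊗ₜ[k] s) * q)) =
        s * TensorProduct.lid k _ ((φ ∘ₗ LinearMap.mulLeft k r).rTensor _ q) := by
    clear hS hUφ
    induction q with
    | zero => simp
    | tmul a b => simp
    | add a b ha hb => simp only [mul_add, map_add, ha, hb]
  choose φ hφ using fun j : S => TensorProduct.exists_rTensor_ne_zero (hS j j.2).1
  let v (j : S) : U := ⟨TensorProduct.lid k _
    ((φ j ∘ₗ LinearMap.mulLeft k (Pi.single j.1 1)).rTensor _ q), hUφ _⟩
  have hv (j : S) : (v j).1 ≠ 0 := by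
    have := hφ j
    rwa [key, one_mul] at this
  have hv' (j : S) : (v j).1 = Pi.single j.1 1 * (v j).1 := by
    have h := key (Pi.single j.1 1) (1 - Pi.single j.1 1) (φ j)
    rw [(hS j j.2).2, map_zero, map_zero, sub_mul, one_mul, eq_comm, sub_eq_zero] at h
    exact h
  have hne (i j : S) (h : i ≠ j) : (v i).1 j.1 = 0 := by
    rw [hv' i, Pi.mul_apply, Pi.single_eq_of_ne (fun h' => h (Subtype.ext h'.symm)), zero_mul]
  have hli : LinearIndependent k v := by
    refine LinearIndependent.of_comp U.subtype (linearIndependent_iff'.2 fun s c hc i hi => ?_)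
    have h := congrFun hc i.1
    rw [Finset.sum_apply, Finset.sum_eq_single i] at h
    · refine (smul_eq_zero.1 h).resolve_right fun h0 => hv i ?_
      rw [hv' i]
      ext j
      by_cases hj : j = i.1
      · subst hj
        exact (congrArg _ h0).trans (mul_zero _)
      · rw [Pi.mul_apply, Pi.single_eq_of_ne hj, zero_mul]
        rfl
    · exact fun j _ hj => by simp [hne j i hj]
    · exact fun h' => (h' hi).elim
  have : Module.Finite k U := Module.Finite.iff_fg.2 hU
  have := hli.finite
  exact Set.toFinite S

/-! ### The annihilator of the difference of the two generators -/

namespace Polynomial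

/-- The monic irreducible polynomials over a field. -/
abbrev MonicIrreducible (k : Type u) [Field k] : Type u := {p : k[X] // p.Monic ∧ Irreducible p}

namespace MonicIrreducible

variable {k : Type u} [Field k]

instance (p : MonicIrreducible k) : Fact (Irreducible p.1) := ⟨p.2.2⟩

theorem eq_of_dvd {p q : MonicIrreducible k} (h : p.1 ∣ q.1) : p = q :=
  Subtype.ext (eq_of_monic_of_associated p.2.1 q.2.1 (p.2.2.associated_of_dvd q.2.2 h))

/-- Euclid's argument, which also covers finite `k`. The factor `X` makes `P` nonconstant, so `P +
1` is not a unit. -/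
instance : Infinite (MonicIrreducible k) := by
  by_contra h
  rw [not_infinite_iff_finite] at h
  have := Fintype.ofFinite (MonicIrreducible k)
  let P : k[X] := ∏ p : MonicIrreducible k, p.1
  have hdvd (p : MonicIrreducible k) : p.1 ∣ P := Finset.dvd_prod_of_mem _ (Finset.mem_univ p)
  have hP : P ≠ 0 := Finset.prod_ne_zero_iff.2 fun p _ => p.2.2.ne_zero
  have hX : (X : k[X]) ∣ P := hdvd ⟨X, monic_X, irreducible_X⟩
  have hdeg : 0 < P.natDegree := by
    have := natDegree_le_of_dvd hX hP
    rw [natDegree_X] at this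
    omega
  have hunit : ¬ IsUnit (P + 1) := fun hu => by
    have := natDegree_eq_zero_of_isUnit hu
    rw [← C_1, natDegree_add_C] at this
    exact hdeg.ne' this
  obtain ⟨p, hm, hi, hp⟩ := exists_monic_irreducible_factor (P + 1) hunit
  exact hi.not_isUnit (isUnit_of_dvd_one ((dvd_add_right (hdvd ⟨p, hm, hi⟩)).1 hp))

variable (k) in
/-- The product of all fields generated by one algebraic element. -/
abbrev ProdFields : Type u := ∀ p : MonicIrreducible k, AdjoinRoot p.1

variable (k) in
/-- The family of the generators. -/
noncomputable def root : ProdFields k := fun p => AdjoinRoot.root p.1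

open Classical in
/-- The idempotent supported at `p`. -/
noncomputable def idem (p : MonicIrreducible k) : ProdFields k := Pi.single p 1

theorem aeval_root_apply (f : k[X]) (p : MonicIrreducible k) :
    aeval (root k) f p = AdjoinRoot.mk p.1 f := by
  have := aeval_algHom_apply (Pi.evalAlgHom k (fun p : MonicIrreducible k => AdjoinRoot p.1) p)
    (root k) f
  rw [← AdjoinRoot.aeval_eq]
  exact this.symm

variable (k) in
/-- The difference of the two copies of the generator. -/
noncomputable def rootDiff : ProdFields k ⊗[k] ProdFields k := root k ⊗ₜ 1 - 1 ⊗ₜ root k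

/-- The element `y = p(root)` vanishes exactly in coordinate `p`, and it may be moved across the
tensor sign in front of `q`. Since `1 - idem p` is a multiple of `y` while `idem p * y = 0`, the
product vanishes. -/
theorem idem_tmul_mul_eq_zero {q : ProdFields k ⊗[k] ProdFields k} (hq : rootDiff k * q = 0)
    (p : MonicIrreducible k) : (idem p ⊗ₜ[k] (1 - idem p)) * q = 0 := by
  classical
  let y := aeval (root k) p.1
  have hdvd : rootDiff k ∣ y ⊗ₜ 1 - 1 ⊗ₜ y := by
    have h := sub_dvd_eval_sub (root k ⊗ₜ[k] (1 : ProdFields k)) ((1 : ProdFields k) ⊗ₜ[k] root k)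
      (p.1.map (algebraMap k (ProdFields k ⊗[k] ProdFields k)))
    rw [eval_map_algebraMap, eval_map_algebraMap] at h
    have h1 := aeval_algHom_apply (Algebra.TensorProduct.includeLeft :
      ProdFields k →ₐ[k] ProdFields k ⊗[k] ProdFields k) (root k) p.1
    have h2 := aeval_algHom_apply (Algebra.TensorProduct.includeRight :
      ProdFields k →ₐ[k] ProdFields k ⊗[k] ProdFields k) (root k) p.1
    rw [Algebra.TensorProduct.includeLeft_apply, Algebra.TensorProduct.includeLeft_apply] at h1
    rw [Algebra.TensorProduct.includeRight_apply, Algebra.TensorProduct.includeRight_apply] at h2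
    rwa [h1, h2] at h
  obtain ⟨c, hc⟩ := hdvd
  have hyq : (y ⊗ₜ 1 - 1 ⊗ₜ y) * q = 0 := by rw [hc, mul_right_comm, hq, zero_mul]
  have hy0 : idem p * y = 0 := by
    ext j
    by_cases hj : j = p
    · subst hj
      simp [y, aeval_root_apply]
    · simp [idem, hj]
  -- Only the coordinates other than `p` matter, as `y` vanishes at `p`.
  let w : ProdFields k := fun j => (y j)⁻¹
  have hw : w * y = 1 - idem p := by
    ext j
    by_cases hj : j = p
    · subst hj
      simp [y, aeval_root_apply, idem]
    · have : y j ≠ 0 := by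
        rw [show y j = _ from aeval_root_apply _ _, Ne, AdjoinRoot.mk_eq_zero]
        exact fun h => hj (eq_of_dvd h)
      simp [idem, hj, w, this]
  rw [sub_mul, sub_eq_zero] at hyq
  calc (idem p ⊗ₜ[k] (1 - idem p)) * q = (idem p ⊗ₜ[k] w) * ((1 ⊗ₜ y) * q) := by
        rw [← mul_assoc, Algebra.TensorProduct.tmul_mul_tmul, hw, mul_one]
    _ = 0 := by
        rw [← hyq, ← mul_assoc, Algebra.TensorProduct.tmul_mul_tmul, hy0, TensorProduct.zero_tmul,
          zero_mul]

open Classical in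
theorem eventually_idem_tmul_mul_eq_zero {q : ProdFields k ⊗[k] ProdFields k}
    (hq : rootDiff k * q = 0) :
    ∀ᶠ p in Filter.cofinite, (idem p ⊗ₜ[k] (1 : ProdFields k)) * q = 0 := by
  exact Pi.finite_setOf_single_tmul_ne_zero q _ fun p hp =>
    ⟨hp, idem_tmul_mul_eq_zero hq p⟩

/-- Multiplication into the field `AdjoinRoot p.1` kills the difference, so it is no unit; in an
Artinian ring a non-unit is a zero divisor. -/
theorem exists_mul_root_diff_eq_zero (p : MonicIrreducible k) :
    ∃ c : AdjoinRoot p.1 ⊗[k] AdjoinRoot p.1, c ≠ 0 ∧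
      (AdjoinRoot.root p.1 ⊗ₜ 1 - 1 ⊗ₜ AdjoinRoot.root p.1) * c = 0 := by
  have : Module.Finite k (AdjoinRoot p.1) := p.2.1.finite_adjoinRoot
  have : IsArtinianRing (AdjoinRoot p.1 ⊗[k] AdjoinRoot p.1) := IsArtinianRing.of_finite k _
  by_contra! h
  have hu : IsUnit (AdjoinRoot.root p.1 ⊗ₜ[k] (1 : AdjoinRoot p.1) - 1 ⊗ₜ AdjoinRoot.root p.1) := by
    refine IsArtinianRing.isUnit_of_mem_nonZeroDivisors (mem_nonZeroDivisors_iff_right.2 ?_)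
    intro c hc
    by_contra hc0
    exact h c hc0 (by rw [mul_comm, hc])
  have := hu.map (Algebra.TensorProduct.lmul' k : AdjoinRoot p.1 ⊗[k] AdjoinRoot p.1 →ₐ[k] _)
  simp at this

theorem exists_rootDiff_mul_eq_zero (p : MonicIrreducible k) :
    ∃ g : ProdFields k ⊗[k] ProdFields k, rootDiff k * g = 0 ∧
      (idem p ⊗ₜ[k] (1 : ProdFields k)) * g ≠ 0 := by
  classical
  obtain ⟨c, hc0, hc⟩ := exists_mul_root_diff_eq_zero p
  -- Extension by zero carries the annihilating element from the factor at `p` to the product; the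
  -- projection `r` shows that it stays nonzero.
  let s : AdjoinRoot p.1 →ₗ[k] ProdFields k := LinearMap.single k (fun p : MonicIrreducible k => AdjoinRoot p.1) p
  let r : ProdFields k →ₗ[k] AdjoinRoot p.1 := LinearMap.proj p
  have hrs : r ∘ₗ s = LinearMap.id := LinearMap.proj_comp_single_same k _ p
  have hroot (a : AdjoinRoot p.1) : root k * s a = s (AdjoinRoot.root p.1 * a) := by
    ext j
    by_cases hj : j = p
    · subst hj
      simp [s, root]
    · simp [s, hj]
  have hidem (a : AdjoinRoot p.1) : idem p * s a = s a := by
    ext j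
    by_cases hj : j = p
    · subst hj
      simp [s, idem]
    · simp [s, hj]
  have h1 (c) : rootDiff k * TensorProduct.map s s c = TensorProduct.map s s
      ((AdjoinRoot.root p.1 ⊗ₜ 1 - 1 ⊗ₜ AdjoinRoot.root p.1) * c) := by
    induction c with
    | zero => simp
    | tmul a b => simp [rootDiff, sub_mul, hroot]
    | add a b ha hb => simp only [mul_add, map_add, ha, hb]
  have h2 (c) : (idem p ⊗ₜ[k] (1 : ProdFields k)) * TensorProduct.map s s c =
      TensorProduct.map s s c := by
    induction c with
    | zero => simp
    | tmul a b => simp [hidem]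
    | add a b ha hb => simp only [mul_add, map_add, ha, hb]
  refine ⟨TensorProduct.map s s c, by rw [h1, hc, map_zero], fun h => hc0 ?_⟩
  rw [h2] at h
  have h3 := congrArg (TensorProduct.map r r) h
  rwa [map_zero, ← LinearMap.comp_apply, ← TensorProduct.map_comp, hrs, TensorProduct.map_id,
    LinearMap.id_apply] at h3

end MonicIrreducible

end Polynomial

/-! ### Consequences of universality -/

namespace DeligneTensor

section

variable {k : Type u} [CommRing k] {A : Type w₁} [Category.{v₁} A] [Preadditive A] [Linear k A]
  {B : Type w₂} [Category.{v₂} B] [Preadditive B] [Linear k B]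
  {T : Type w₃} [Category.{v₃} T] [Preadditive T] [Linear k T] {χ : A ⥤ B ⥤ T}
  (hχ : IsRexBilinear k χ) (C : Type w) [Category.{v} C] [Preadditive C] [Linear k C]

theorem exists_isRex_iso [(rexPrecomp hχ C).EssSurj] {Ψ : A ⥤ B ⥤ C} (hΨ : IsRexBilinear k Ψ) :
    ∃ F : T ⥤ C, IsRex k F ∧ Nonempty ((precomp χ C).obj F ≅ Ψ) :=
  let F := (rexPrecomp hχ C).objPreimage ⟨Ψ, hΨ⟩
  ⟨F.obj, F.property, ⟨(ObjectProperty.ι _).mapIso ((rexPrecomp hχ C).objObjPreimageIso ⟨Ψ, hΨ⟩)⟩⟩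

/-- Conservativity of composition with `χ` stands in for generation of `T` by the values of `χ`. -/
theorem isIso_of_isIso_app [(rexPrecomp hχ C).ReflectsIsomorphisms] {F F' : T ⥤ C}
    (hF : IsRex k F) (hF' : IsRex k F') (τ : F ⟶ F')
    (h : ∀ a b, IsIso (τ.app ((χ.obj a).obj b))) : IsIso τ := by
  let τ' : (⟨F, hF⟩ : Rex k T C) ⟶ ⟨F', hF'⟩ := ⟨τ⟩
  have h1 : IsIso ((precomp χ C).map τ) := by
    refine (NatTrans.isIso_iff_isIso_app _).2 fun a => (NatTrans.isIso_iff_isIso_app _).2 fun b => ?_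
    exact h a b
  have h2 : IsIso ((rexPrecomp hχ C).map τ') :=
    have : IsIso ((ObjectProperty.ι _).map ((rexPrecomp hχ C).map τ')) := h1
    isIso_of_fully_faithful (ObjectProperty.ι _) _
  have := isIso_of_reflects_iso τ' (rexPrecomp hχ C)
  exact inferInstanceAs (IsIso ((ObjectProperty.ι _).map τ'))

end

end DeligneTensor

namespace MatCat

open Idempotents DeligneTensor

section

variable {k R : Type u} [Field k] [CommRing R] [Algebra k R]
  {T : Type w} [Category.{v} T] [Preadditive T] [Linear k T]
  {χ : Karoubi (MatCat R) ⥤ Karoubi (MatCat R) ⥤ T} (hχ : IsRexBilinear k χ)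

/-- The action of `R ⊗ R` on the value of a bilinear functor at the free modules of rank one. -/
noncomputable def endAction : R ⊗[k] R →ₗ[k]
    ((χ.obj (one R)).obj (one R) ⟶ (χ.obj (one R)).obj (one R)) :=
  have := (hχ.right (one R)).additive
  have := (hχ.right (one R)).linear
  have := (hχ.left (one R)).additive
  have := (hχ.left (one R)).linear
  TensorProduct.lift (LinearMap.mk₂ k
    (fun r s => (χ.flip.obj (one R)).map (r • 𝟙 (one R)) ≫ (χ.obj (one R)).map (s • 𝟙 (one R)))
    (fun r r' s => by rw [add_smul, Functor.map_add, Preadditive.add_comp])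
    (fun c r s => by rw [smul_smul_hom, Functor.map_smul (R := k), Linear.smul_comp])
    (fun r s s' => by rw [add_smul, Functor.map_add, Preadditive.comp_add])
    (fun c r s => by rw [smul_smul_hom, Functor.map_smul (R := k), Linear.comp_smul]))

theorem endAction_tmul (r s : R) :
    endAction hχ (r ⊗ₜ s) =
      (χ.map (r • 𝟙 (one R))).app (one R) ≫ (χ.obj (one R)).map (s • 𝟙 (one R)) := rfl

theorem endAction_mul (p q : R ⊗[k] R) :
    endAction hχ (p * q) = endAction hχ p ≫ endAction hχ q := by
  induction p with
  | zero => simp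
  | add a b ha hb => rw [add_mul, map_add, map_add, ha, hb, Preadditive.add_comp]
  | tmul r s =>
    induction q with
    | zero => simp
    | add a b ha hb => rw [mul_add, map_add, map_add, ha, hb, Preadditive.comp_add]
    | tmul r' s' =>
      have h (a b : R) : (a * b) • 𝟙 (one R) = (a • 𝟙 (one R)) ≫ (b • 𝟙 (one R)) := by
        rw [Linear.smul_comp, Category.id_comp, smul_smul]
      rw [Algebra.TensorProduct.tmul_mul_tmul, endAction_tmul, endAction_tmul, endAction_tmul, h, h,
        Functor.map_comp, Functor.map_comp, NatTrans.comp_app, Category.assoc, Category.assoc,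
        ← NatTrans.naturality_assoc]

/-- For `Q = R ⊗ R` with its two inclusions the lift is the identity, so `F` turns the action of `q`
into multiplication by `q`. -/
theorem map_endAction {Q : Type u} [CommRing Q] [Algebra k Q] (φ ψ : R →ₐ[k] Q)
    {F : T ⥤ ModuleCat.{u} Q} [F.Additive]
    (e : (precomp χ _).obj F ≅ extendTensor φ.toRingHom ψ.toRingHom) (q : R ⊗[k] R) :
    F.map (endAction hχ q) =
      Algebra.TensorProduct.lift φ ψ (fun _ _ => Commute.all _ _) q • 𝟙 _ := by
  induction q with
  | zero => simp
  | add a b ha hb => rw [map_add, map_add, F.map_add, ha, hb, add_smul]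
  | tmul r s =>
    have h1 : F.map ((χ.map (r • 𝟙 (one R))).app (one R)) = φ r • 𝟙 _ := by
      have h := NatTrans.congr_app (e.hom.naturality (r • 𝟙 (one R))) (one R)
      rw [NatTrans.comp_app, NatTrans.comp_app, extendTensor_map_smul_app, CategoryTheory.Functor.map_id,
        NatTrans.id_app, Linear.comp_smul, Category.comp_id] at h
      rw [← cancel_mono ((e.hom.app (one R)).app (one R)), Linear.smul_comp, Category.id_comp]
      exact h
    have h2 : F.map ((χ.obj (one R)).map (s • 𝟙 (one R))) = ψ s • 𝟙 _ := by
      have h := (e.hom.app (one R)).naturality (s • 𝟙 (one R))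
      rw [extendTensor_obj_map_smul, CategoryTheory.Functor.map_id, Linear.comp_smul, Category.comp_id] at h
      rw [← cancel_mono ((e.hom.app (one R)).app (one R)), Linear.smul_comp, Category.id_comp]
      exact h
    rw [endAction_tmul, F.map_comp, h1, h2, Linear.smul_comp, Category.id_comp, smul_smul,
      Algebra.TensorProduct.lift_tmul]

end

/-- If `χ` is universal among bilinear right exact functors, then for every object `X` of the
target, the canonical map `F X ⊗ Q ^ J ⟶ (F X) ^ J` is an isomorphism. -/
theorem isIso_tensorToPower_app {k R Q : Type u} [Field k] [CommRing R] [Algebra k R] [CommRing Q]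
    [Algebra k Q] {T : Type w} [Category.{v} T] [Preadditive T] [Linear k T]
    {χ : Karoubi (MatCat R) ⥤ Karoubi (MatCat R) ⥤ T} (hχ : IsRexBilinear k χ)
    [(rexPrecomp hχ (ModuleCat.{u} Q)).ReflectsIsomorphisms]
    {F : T ⥤ ModuleCat.{u} Q} (hF : IsRex k F)
    (θ : F.obj ((χ.obj (one R)).obj (one R)) ≅ ModuleCat.of Q Q) (J : Type u) (X : T) :
    IsIso ((ModuleCat.tensorToPower J).app (F.obj X)) := by
  have := hF.additive
  have := isIso_of_isIso_app hχ _ (hF.comp (isRex_tensorRight (ModuleCat.of Q (J → Q))))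
    (hF.comp (isRex_power J)) (Functor.whiskerLeft F (ModuleCat.tensorToPower J)) fun a b => by
      have h1 : IsSummandOfSum (ModuleCat.of Q Q) (F.obj ((χ.obj (one R)).obj (one R))) :=
        ⟨1, fun _ => θ.hom, fun _ => θ.inv, by simp⟩
      have := (hχ.left (one R)).additive
      have := (hχ.right a).additive
      -- One variable at a time, `F χ(a, b)` is reduced to `F χ(R, R) ≅ Q`.
      exact ((h1.trans ((isSummandOfSum_one R a).map (χ.flip.obj (one R) ⋙ F))).trans
        ((isSummandOfSum_one R b).map (χ.obj a ⋙ F))).isIso_app (ModuleCat.tensorToPower J)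
  exact inferInstanceAs (IsIso ((Functor.whiskerLeft F (ModuleCat.tensorToPower J)).app X))

end MatCat

/-! ### The contradiction -/

/-- A tensor involves only finitely many elements of `M`, and finitely many eventual conditions hold
together. -/
theorem ModuleCat.eventually_smul_map_tensorToPower_eq_zero {Q J : Type u} [CommRing Q]
    {M N : ModuleCat.{u} Q} (f : M ⟶ N) (l : Filter J) (e : J → Q)
    (h : ∀ m : M, ∀ᶠ j in l, e j • f m = 0) (z : (M ⊗[Q] (J → Q) : Type u)) :
    ∀ᶠ j in l, e j • f (((ModuleCat.tensorToPower J).app M z : J → M) j) = 0 := by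
  let F (j : J) : (M ⊗[Q] (J → Q) : Type u) →ₗ[Q] N :=
    f.hom ∘ₗ LinearMap.proj j ∘ₗ ((tensorToPower J).app M).hom
  change ∀ᶠ j in l, e j • F j z = 0
  induction z using TensorProduct.induction_on with
  | zero => exact .of_forall fun j => by rw [map_zero, smul_zero]
  | tmul m w =>
    filter_upwards [h m] with j hj
    change e j • f (w j • m) = 0
    rw [map_smul, smul_comm, hj, smul_zero]
  | add x y hx hy =>
    filter_upwards [hx, hy] with j hj hj'
    rw [map_add, smul_add, hj, hj', add_zero]

open Idempotents DeligneTensor Polynomial in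
theorem Polynomial.MonicIrreducible.not_hasDeligneTensor {k : Type u} [Field k]
    {T : Type (u + 1)} [Category.{u} T] [Abelian T] [Linear k T]
    {χ : Karoubi (MatCat (ProdFields k)) ⥤ Karoubi (MatCat (ProdFields k)) ⥤ T}
    (hχ : IsRexBilinear k χ)
    (h : (rexPrecomp hχ (ModuleCat.{u} (ProdFields k ⊗[k] ProdFields k))).IsEquivalence) :
    False := by
  let Q := ProdFields k ⊗[k] ProdFields k
  let φ : ProdFields k →ₐ[k] Q := Algebra.TensorProduct.includeLeft
  let ψ : ProdFields k →ₐ[k] Q := Algebra.TensorProduct.includeRight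
  obtain ⟨F, hF, ⟨e⟩⟩ := exists_isRex_iso hχ (ModuleCat.{u} Q)
    (MatCat.isRexBilinear_extendTensor (MatCat.isRegularCategory_pi _) φ ψ)
  have := hF.additive
  let θ := (e.app (MatCat.one _)).app (MatCat.one _) ≪≫
    MatCat.extendTensorOne φ.toRingHom ψ.toRingHom
  have hlift (q : Q) : Algebra.TensorProduct.lift φ ψ (fun _ _ => Commute.all _ _) q = q := by
    exact AlgHom.congr_fun Algebra.TensorProduct.lift_includeLeft_includeRight q
  have hmap (q : Q) : F.map (MatCat.endAction hχ q) = q • 𝟙 _ := by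
    rw [MatCat.map_endAction hχ φ ψ e, hlift]
  have := MatCat.isIso_tensorToPower_app hχ hF θ (MonicIrreducible k)
    (kernel (MatCat.endAction hχ (rootDiff k)))
  choose g hg hg' using exists_rootDiff_mul_eq_zero (k := k)
  let t (p) := kernel.lift (MatCat.endAction hχ (rootDiff k)) (MatCat.endAction hχ (g p)) (by
    rw [← MatCat.endAction_mul, mul_comm, hg, map_zero])
  let v := θ.inv (1 : Q)
  -- The family maps to `(g p)` in `Q`; surjectivity writes it with finitely many elements of `F` of
  -- the kernel.
  obtain ⟨z, hz⟩ := ((ConcreteCategory.isIso_iff_bijective _).1 this).2 (fun p => F.map (t p) v)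
  have hev := ModuleCat.eventually_smul_map_tensorToPower_eq_zero
    (F.map (kernel.ι (MatCat.endAction hχ (rootDiff k))) ≫ θ.hom) Filter.cofinite
    (fun p => (idem p ⊗ₜ[k] (1 : ProdFields k) : Q)) (fun m => by
      -- `F` need not preserve the kernel, but the image of `m` in `Q` is still killed by `rootDiff
      -- k`.
      refine eventually_idem_tmul_mul_eq_zero ?_
      rw [ModuleCat.comp_apply]
      refine ((θ.hom.hom.map_smul (rootDiff k) _).symm.trans (congrArg θ.hom ?_)).trans
        (map_zero θ.hom.hom)
      have := ConcreteCategory.congr_hom (hmap (rootDiff k)) (F.map (kernel.ι _) m)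
      refine this.symm.trans ?_
      rw [← ModuleCat.comp_apply, ← F.map_comp, kernel.condition, F.map_zero]
      rfl) z
  rw [hz] at hev
  -- The cofinite filter is nontrivial because there are infinitely many `p`.
  obtain ⟨p, hp⟩ := hev.exists
  refine hg' p ?_
  have hgp : F.map (t p) ≫ F.map (kernel.ι _) = g p • 𝟙 _ := by
    rw [← F.map_comp, kernel.lift_ι, hmap]
  have hv : (F.map (kernel.ι (MatCat.endAction hχ (rootDiff k))) ≫ θ.hom) (F.map (t p) v) = g p := by
    rw [ModuleCat.comp_apply, ← ModuleCat.comp_apply (F.map (t p)), hgp]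
    refine (θ.hom.hom.map_smul (g p) v).trans ?_
    change g p • (θ.inv ≫ θ.hom) (1 : Q) = g p
    rw [θ.inv_hom_id]
    exact mul_one _
  rw [hv] at hp
  exact hp

open Idempotents DeligneTensor Polynomial in
theorem mainTheorem2 (k : Type u) [Field k] :
    ∃ (A B : Type u) (_ : SmallCategory A) (_ : SmallCategory B) (_ : Abelian A) (_ : Abelian B)
      (_ : Linear k A) (_ : Linear k B), ¬ DeligneTensor.HasDeligneTensor k A B := by
  let _ : Abelian (Karoubi (MatCat (MonicIrreducible.ProdFields k))) :=
    (Karoubi.isRegularCategory (MatCat.isRegularCategory_pi _)).abelian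
  refine ⟨Karoubi (MatCat (MonicIrreducible.ProdFields k)),
    Karoubi (MatCat (MonicIrreducible.ProdFields k)), inferInstance, inferInstance, inferInstance,
    inferInstance, inferInstanceAs (Linear k (Karoubi (MatCat (MonicIrreducible.ProdFields k)))),
    inferInstanceAs (Linear k (Karoubi (MatCat (MonicIrreducible.ProdFields k)))), ?_⟩
  rintro ⟨T, _, _, _, χ, hχ⟩
  exact MonicIrreducible.not_hasDeligneTensor hχ.isRexBilinear (hχ.isEquivalence _)
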